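/- Let $G$ be a finite simple connected graph of order $n\ge 3$. For a finite Abelian group $\mathcal G$ (written additively) and an edge labelling $f:E(G)\to\mathcal G$, the weighted degree of a vertex $v$ is $w(v)=\sum_{e\ni v}f(e)$, and $f$ is called $\mathcal G$-irregular if the weighted degrees of all vertices are pairwise distinct. Let $s_g(G)$ be the smallest positive integer $s$ such that, for every Abelian group $\mathcal G$ of order $s$, $G$ admits a $\mathcal G$-irregular labelling. Then, for every integer $k>s_g(G)$ and every Abelian group $\mathcal G$ of order $k$, $G$ admits a $\mathcal G$-irregular labelling if and only if neither of the following two cases occurs: 1. $G\cong K_{1,n-1}$ and $\mathcal G\cong(\mathbb Z_3)^q$ for some integer $q\ge 0$ with $3^q=n+1$; 2. $\mathcal G\cong(\mathbb Z_2)^q$ for some integer $q\ge 0$ with $2^q=n+2$. -/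

import Mathlib

open Classical in
/-- The weighted degree of the vertex `v` under the edge labelling `f : E(G) → Γ`: the sum of the
labels of all edges incident with `v`. -/
noncomputable def SimpleGraph.weightedDegree {V Γ : Type*} [Fintype V] [AddCommGroup Γ]
    (G : SimpleGraph V) (f : G.edgeSet → Γ) (v : V) : Γ :=
  ∑ e ∈ Finset.univ.filter (fun e : G.edgeSet => v ∈ (e : Sym2 V)), f e

/-- An edge labelling is `Γ`-irregular if the weighted degrees of distinct vertices are distinct. -/
def SimpleGraph.IsGroupIrregular {V Γ : Type*} [Fintype V] [AddCommGroup Γ]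
    (G : SimpleGraph V) (f : G.edgeSet → Γ) : Prop :=
  Function.Injective (G.weightedDegree f)

/-- `G` admits a `Γ`-irregular labelling of its edges. -/
def SimpleGraph.AdmitsIrregularLabelling {V : Type*} [Fintype V] (G : SimpleGraph V)
    (Γ : Type*) [AddCommGroup Γ] : Prop :=
  ∃ f : G.edgeSet → Γ, G.IsGroupIrregular f

/-- The group irregularity strength `s_g(G)`: the smallest positive integer `s` such that `G` admits
a `Γ`-irregular labelling for every Abelian group `Γ` of order `s`. (There is no group of order `0`;
since `0 < s`, the condition `Nat.card Γ = s` makes `Γ` finite.) -/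
noncomputable def SimpleGraph.groupIrregularityStrength {V : Type*} [Fintype V]
    (G : SimpleGraph V) : ℕ :=
  sInf {s : ℕ | 0 < s ∧
    ∀ (Γ : Type) [AddCommGroup Γ], Nat.card Γ = s → G.AdmitsIrregularLabelling Γ}

/-!
Let `n` be the order of the connected graph `G`. Labelling the edges of a walk alternately by `x` and
`-x` changes the weighted degrees only at its two ends, so all weights can be moved to a root
(`SimpleGraph.single_sub_single_mem`). Hence (`SimpleGraph.realizableWeights_cases`) the functions
`V → Γ` that occur as weighted degrees include all those with equal totals on the two sides of the
bipartition if `G` is bipartite, and all those whose total lies in `2Γ` otherwise. In both cases it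
suffices to find a *balanced pair*: disjoint subsets of `Γ` with prescribed sizes `a + b = n` and
equal sums. Only in the bipartite case are `a` and `b` forced.

`hasBalancedPair` shows that for `3 ≤ n < |Γ|` a balanced pair exists outside the two exceptional
families. Pairs `{x, -x}` with `x ≠ -x` are neutral, so they serve to enlarge a small balanced pair
(`hasBalancedPair_of_freelySymmetric`), and the question is about parity and about the 2-torsion
`Γ[2]`. A zero-sum subset of `Γ[2]` may be split arbitrarily, both parts having the same sum
(`hasBalancedPair_of_zero_sum_twoTorsion`). Zero-sum subsets of `Γ[2]` of order `m` exist in every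
odd size (translate) and, if `m ≥ 4`, in all sizes `j ≥ 4` with `j = m` or `j ≤ m - 4`
(`exists_zero_sum`), which is enough unless `Γ = Γ[2]` has order `n + 2`, where no balanced
pair exists, or `a` and `b` are odd and `m ≤ 2`. In the latter case a triple
`x + y + z = 0` is used to correct the parity (`hasBalancedPair_of_odd_of_odd`), except when
`a = 1` and `|Γ| = n + m`, which is done by hand; this last case is where stars with
`Γ = (ℤ/3)^q` fail.

Since a group of order `n + 3` is never exceptional, `s_g(G)` is attained and at least `n`, so that
`k > s_g(G)` gives `|Γ| > n`. For the converse, the sum of all weighted degrees is twice the sum of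
the labels, and the weighted degrees are all elements of `Γ` but one or two; as the elements of `Γ`
sum to zero, the two omitted elements of `(ℤ/2)^q` would coincide, and the omitted element of
`(ℤ/3)^q` would be the weighted degree of the centre of the star.
-/

/-! ### Symmetric sets without fixed points -/

section Symmetric

variable {Γ : Type*} [AddCommGroup Γ]

/-- A finite set is freely symmetric if it is closed under negation and negation has no fixed point
on it, that is, if it is a disjoint union of pairs `{x, -x}` with `x ≠ -x`. -/
def FreelySymmetric (S : Finset Γ) : Prop :=
  ∀ x ∈ S, -x ∈ S ∧ x + x ≠ 0

lemma FreelySymmetric.sum_eq_zero {S : Finset Γ} (hS : FreelySymmetric S) : ∑ x ∈ S, x = 0 := by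
  refine Finset.sum_involution (fun x _ => -x) ?_ ?_ ?_ ?_
  · intro a _; simp
  · intro a ha _ h
    exact (hS a ha).2 (by nth_rewrite 1 [← h]; simp)
  · intro a ha; exact (hS a ha).1
  · intro a _; simp

lemma FreelySymmetric.even_card {S : Finset Γ} (hS : FreelySymmetric S) : Even S.card := by
  have h : ∑ _x ∈ S, (1 : ZMod 2) = 0 := by
    refine Finset.sum_involution (fun x _ => -x) ?_ ?_ ?_ ?_
    · intro a _; decide
    · intro a ha _ h
      exact (hS a ha).2 (by nth_rewrite 1 [← h]; simp)
    · intro a ha; exact (hS a ha).1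
    · intro a _; simp
  rw [Finset.sum_const, nsmul_eq_mul, mul_one] at h
  exact (ZMod.natCast_eq_zero_iff_even).1 h

lemma FreelySymmetric.sdiff [DecidableEq Γ] {S R : Finset Γ} (hS : FreelySymmetric S)
    (hR : ∀ x ∈ R, -x ∈ R) : FreelySymmetric (S \ R) := by
  intro x hx
  rw [Finset.mem_sdiff] at hx ⊢
  exact ⟨⟨(hS x hx.1).1, fun h => hx.2 (by simpa using hR _ h)⟩, (hS x hx.1).2⟩

lemma FreelySymmetric.exists_subset [DecidableEq Γ] {S : Finset Γ} (hS : FreelySymmetric S)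
    (t : ℕ) (ht : 2 * t ≤ S.card) : ∃ R ⊆ S, R.card = 2 * t ∧ FreelySymmetric R := by
  induction t with
  | zero => exact ⟨∅, by simp, by simp, fun x hx => by simp at hx⟩
  | succ t ih =>
    obtain ⟨R, hRS, hc, hR⟩ := ih (by omega)
    have hpos : 0 < (S \ R).card := by
      rw [Finset.card_sdiff_of_subset hRS]; omega
    obtain ⟨x, hx⟩ := Finset.card_pos.1 hpos
    have hD := hS.sdiff (fun x hx => (hR x hx).1) x hx
    rw [Finset.mem_sdiff] at hx hD
    have hne : x ≠ -x := fun h => hD.2 (by nth_rewrite 1 [h]; simp)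
    refine ⟨insert x (insert (-x) R), ?_, ?_, ?_⟩
    · intro y hy
      simp only [Finset.mem_insert] at hy
      rcases hy with rfl | rfl | hy
      exacts [hx.1, hD.1.1, hRS hy]
    · rw [Finset.card_insert_of_notMem, Finset.card_insert_of_notMem, hc]
      · ring
      · exact hD.1.2
      · simp [hne, hx.2]
    · intro y hy
      simp only [Finset.mem_insert] at hy ⊢
      rcases hy with rfl | rfl | hy
      · exact ⟨by simp, hD.2⟩
      · refine ⟨by simp, fun h => hD.2 ?_⟩
        rw [← neg_add, neg_eq_zero] at h; exact h
      · exact ⟨by simp [(hR y hy).1], (hR y hy).2⟩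

/-- The group `Γ` contains disjoint sets of `a` and `b` elements with equal sums. -/
def HasBalancedPair (Γ : Type*) [AddCommGroup Γ] (a b : ℕ) : Prop :=
  ∃ P Q : Finset Γ, Disjoint P Q ∧ P.card = a ∧ Q.card = b ∧ ∑ x ∈ P, x = ∑ x ∈ Q, x

lemma HasBalancedPair.symm {a b : ℕ} (h : HasBalancedPair Γ a b) : HasBalancedPair Γ b a := by
  obtain ⟨P, Q, h1, h2, h3, h4⟩ := h
  exact ⟨Q, P, h1.symm, h3, h2, h4.symm⟩

/-- Pairs `{x, -x}` add nothing to a sum, so a balanced pair of sets can be enlarged by pairs taken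
from a freely symmetric set that avoids it. -/
lemma hasBalancedPair_of_freelySymmetric [DecidableEq Γ] {P Q S : Finset Γ}
    (hPQ : Disjoint P Q) (hPS : Disjoint P S) (hQS : Disjoint Q S) (hS : FreelySymmetric S)
    (hsum : ∑ x ∈ P, x = ∑ x ∈ Q, x) {a b p q : ℕ} (ha : a = P.card + 2 * p)
    (hb : b = Q.card + 2 * q) (hpq : 2 * p + 2 * q ≤ S.card) : HasBalancedPair Γ a b := by
  obtain ⟨R, hRS, hRc, hR⟩ := hS.exists_subset p (by omega)
  obtain ⟨R', hRS', hRc', hR'⟩ := (hS.sdiff (fun x hx => (hR x hx).1)).exists_subset q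
    (by rw [Finset.card_sdiff_of_subset hRS]; omega)
  have hd : Disjoint R R' := Finset.disjoint_of_subset_right hRS' Finset.disjoint_sdiff
  have hRS'' : R' ⊆ S := hRS'.trans Finset.sdiff_subset
  have hPR : Disjoint P R := Finset.disjoint_of_subset_right hRS hPS
  have hQR : Disjoint Q R' := Finset.disjoint_of_subset_right hRS'' hQS
  refine ⟨P ∪ R, Q ∪ R', ?_, ?_, ?_, ?_⟩
  · simp only [Finset.disjoint_union_left, Finset.disjoint_union_right]
    exact ⟨⟨hPQ, (Finset.disjoint_of_subset_right hRS hQS).symm⟩,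
      Finset.disjoint_of_subset_right hRS'' hPS, hd⟩
  · rw [Finset.card_union_of_disjoint hPR]; omega
  · rw [Finset.card_union_of_disjoint hQR]; omega
  · rw [Finset.sum_union hPR, Finset.sum_union hQR, hR.sum_eq_zero, hR'.sum_eq_zero, hsum]

end Symmetric

/-! ### Zero-sum subsets of elementary abelian 2-groups -/

section Elementary

variable {E : Type*} [AddCommGroup E]

lemma exists_odd_zero_sum [Fintype E] (hE : ∀ x : E, x + x = 0) {j : ℕ} (hj : Odd j)
    (hjc : j ≤ Fintype.card E) : ∃ J : Finset E, J.card = j ∧ ∑ x ∈ J, x = 0 := by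
  obtain ⟨J, -, hJ⟩ := Finset.exists_subset_card_eq (s := (Finset.univ : Finset E)) (n := j)
    (by simpa using hjc)
  -- Translating by `s := ∑ x ∈ J, x` changes the sum of an odd number of elements by `s`.
  refine ⟨J.map (Equiv.addRight (∑ x ∈ J, x)).toEmbedding, by simpa using hJ, ?_⟩
  obtain ⟨r, rfl⟩ := hj
  simp only [Finset.sum_map, Equiv.coe_toEmbedding, Equiv.coe_addRight]
  rw [Finset.sum_add_distrib, Finset.sum_const, hJ, add_nsmul, mul_comm, mul_nsmul, two_nsmul, hE,
    zero_add, one_nsmul, hE]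

/-- A set closed under translation by `u` is a union of pairs `{x, x + u}` of sum `u`. -/
lemma sum_of_add_closed [DecidableEq E] (hE : ∀ x : E, x + x = 0) {u : E} (hu : u ≠ 0)
    (U : Finset E) (hU : ∀ x ∈ U, x + u ∈ U) : ∑ x ∈ U, x = 0 ∨ ∑ x ∈ U, x = u := by
  induction U using Finset.strongInduction with
  | H U ih =>
    rcases U.eq_empty_or_nonempty with rfl | ⟨x, hx⟩
    · simp
    have hxu : x + u ∈ U.erase x := by simp [hU x hx, hu]
    have hs : ∑ y ∈ U, y = u + ∑ y ∈ (U.erase x).erase (x + u), y := by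
      rw [← Finset.add_sum_erase U (fun y => y) hx,
        ← Finset.add_sum_erase (U.erase x) (fun y => y) hxu, ← add_assoc, ← add_assoc, hE, zero_add]
    have hlt : (U.erase x).erase (x + u) ⊂ U :=
      (Finset.erase_ssubset hxu).trans (Finset.erase_ssubset hx)
    have := ih _ hlt (by
      intro y hy
      simp only [Finset.mem_erase] at hy ⊢
      refine ⟨fun h => hy.2.1 (add_right_cancel h), fun h => hy.1 ?_, hU y hy.2.2⟩
      rw [← h, add_assoc, hE, add_zero])
    rcases this with h | h
    · right; rw [hs, h, add_zero]
    · left; rw [hs, h, hE]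

lemma sum_univ_eq_zero_of_four_le_card [Fintype E] (hE : ∀ x : E, x + x = 0)
    (h4 : 4 ≤ Fintype.card E) : ∑ x : E, x = 0 := by
  classical
  by_contra hσ
  obtain ⟨u, hu⟩ : ∃ u, u ∉ ({0, ∑ x : E, x} : Finset E) := by
    by_contra! h
    have : (Finset.univ : Finset E).card ≤ ({0, ∑ x : E, x} : Finset E).card :=
      Finset.card_le_card fun x _ => h x
    have := Finset.card_le_two (a := (0 : E)) (b := ∑ x : E, x)
    simp only [Finset.card_univ] at *
    omega
  simp only [Finset.mem_insert, Finset.mem_singleton, not_or] at hu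
  rcases sum_of_add_closed hE hu.1 Finset.univ (fun x _ => Finset.mem_univ _) with h | h
  · exact hσ h
  · exact hu.2 h.symm

/-- An exchange argument: if the sum `s` of a `(j - 1)`-element set `J` lies in `J`, then replacing
some `x ∈ J` by some `y ∉ J` moves the sum out of the set; the sum is then added as last element. -/
lemma exists_zero_sum_of_le_half [Fintype E] (hE : ∀ x : E, x + x = 0) {j : ℕ}
    (h4 : 4 ≤ j) (hjc : 2 * j ≤ Fintype.card E) :
    ∃ J : Finset E, J.card = j ∧ ∑ x ∈ J, x = 0 := by
  classical
  suffices h : ∃ J : Finset E, J.card = j - 1 ∧ ∑ x ∈ J, x ∉ J by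
    obtain ⟨J, hc, hJ⟩ := h
    exact ⟨insert (∑ x ∈ J, x) J, by rw [Finset.card_insert_of_notMem hJ]; omega,
      by rw [Finset.sum_insert hJ, hE]⟩
  obtain ⟨J, -, hJ⟩ := Finset.exists_subset_card_eq (s := (Finset.univ : Finset E)) (n := j - 1)
    (by rw [Finset.card_univ]; omega)
  set s := ∑ x ∈ J, x with hs
  by_cases hsJ : s ∈ J
  swap
  · exact ⟨J, hJ, hsJ⟩
  obtain ⟨x, hx, hxs⟩ : ∃ x ∈ J, x ≠ s := by
    by_contra! h
    have : J.card ≤ 1 := Finset.card_le_one.2 fun a ha b hb => by rw [h a ha, h b hb]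
    omega
  obtain ⟨y, hy, hyw⟩ : ∃ y ∉ J, y + (s + x) ∉ J := by
    by_contra! h
    have hle : (Jᶜ).card ≤ J.card :=
      Finset.card_le_card_of_injOn (fun y => y + (s + x))
        (fun y hy => h y (by simpa using hy)) (fun a _ b _ hab => add_right_cancel hab)
    rw [Finset.card_compl] at hle
    omega
  have hye : y ∉ J.erase x := fun h => hy (Finset.mem_of_mem_erase h)
  have hsum : ∑ z ∈ insert y (J.erase x), z = y + (s + x) := by
    rw [Finset.sum_insert hye, hs, ← Finset.add_sum_erase J (fun z => z) hx,
      add_comm x, add_assoc _ x x, hE, add_zero]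
  refine ⟨insert y (J.erase x), ?_, ?_⟩
  · rw [Finset.card_insert_of_notMem hye, Finset.card_erase_of_mem hx]; omega
  · rw [hsum, Finset.mem_insert, not_or]
    refine ⟨fun h => hxs ?_, fun h => hyw (Finset.mem_of_mem_erase h)⟩
    have h0 : s + x = 0 := by simpa using h
    rw [← add_right_cancel_iff (a := x), hE, h0]

lemma exists_zero_sum [Fintype E] (hE : ∀ x : E, x + x = 0) {j : ℕ}
    (h4 : 4 ≤ j) (hjc : j = Fintype.card E ∨ j + 4 ≤ Fintype.card E) :
    ∃ J : Finset E, J.card = j ∧ ∑ x ∈ J, x = 0 := by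
  classical
  rcases hjc with rfl | hjc
  · exact ⟨Finset.univ, by simp, sum_univ_eq_zero_of_four_le_card hE h4⟩
  by_cases h2 : 2 * j ≤ Fintype.card E
  · exact exists_zero_sum_of_le_half hE h4 h2
  -- The whole group has sum zero, so complements of zero-sum sets are zero-sum.
  obtain ⟨J, hc, hJ⟩ := exists_zero_sum_of_le_half hE (j := Fintype.card E - j)
    (by omega) (by omega)
  refine ⟨Jᶜ, by rw [Finset.card_compl]; omega, ?_⟩
  have := Finset.sum_add_sum_compl J (fun x => x)
  rwa [hJ, zero_add, sum_univ_eq_zero_of_four_le_card hE (by omega)] at this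

lemma exists_addEquiv_pi_zmod_of_module (p : ℕ) [Fact p.Prime] [Finite E] [Module (ZMod p) E] :
    ∃ q : ℕ, p ^ q = Nat.card E ∧ Nonempty (E ≃+ (Fin q → ZMod p)) := by
  let e := (Module.finBasis (ZMod p) E).equivFun
  refine ⟨Module.finrank (ZMod p) E, ?_, ⟨e.toAddEquiv⟩⟩
  rw [Nat.card_congr e.toEquiv, Nat.card_fun]
  simp

/-- A finite abelian group killed by a prime `p` is isomorphic to `(ℤ/p)^q`. -/
lemma exists_addEquiv_pi_zmod (p : ℕ) [Fact p.Prime] [Finite E] (hE : ∀ x : E, p • x = 0) :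
    ∃ q : ℕ, p ^ q = Nat.card E ∧ Nonempty (E ≃+ (Fin q → ZMod p)) :=
  @exists_addEquiv_pi_zmod_of_module E _ p _ _ (AddCommGroup.zmodModule hE)

end Elementary

/-! ### Balanced pairs in finite abelian groups -/

section Balanced

variable (Γ : Type*) [AddCommGroup Γ]

/-- The subgroup of all `x` with `x + x = 0`. -/
def twoTorsion : AddSubgroup Γ where
  carrier := {x | x + x = 0}
  zero_mem' := by simp
  add_mem' := by
    intro a b ha hb
    simp only [Set.mem_ofPred_eq] at *
    rw [add_add_add_comm, ha, hb, add_zero]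
  neg_mem' := by
    intro a ha
    simp only [Set.mem_ofPred_eq] at *
    rw [← neg_add, ha, neg_zero]

variable {Γ}

lemma mem_twoTorsion {x : Γ} : x ∈ twoTorsion Γ ↔ x + x = 0 := Iff.rfl

lemma twoTorsion_add_self (x : twoTorsion Γ) : x + x = 0 := Subtype.ext x.2

lemma card_twoTorsion_cases [Finite Γ] :
    Nat.card (twoTorsion Γ) = 1 ∨ Nat.card (twoTorsion Γ) = 2 ∨
      4 ∣ Nat.card (twoTorsion Γ) := by
  have : Fact (Nat.Prime 2) := ⟨Nat.prime_two⟩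
  obtain ⟨q, hq, -⟩ := exists_addEquiv_pi_zmod (E := twoTorsion Γ) 2
    (fun x => by rw [two_nsmul, twoTorsion_add_self])
  rw [← hq]
  rcases q with _ | _ | q
  · simp
  · simp
  · right; right; exact ⟨2 ^ q, by ring⟩

variable [Fintype Γ] [DecidableEq Γ]

lemma card_filter_twoTorsion :
    (Finset.univ.filter fun x : Γ => x + x = 0).card = Nat.card (twoTorsion Γ) := by
  rw [← Fintype.card_subtype, ← Nat.card_eq_fintype_card]
  rfl

lemma freelySymmetric_filter :
    FreelySymmetric (Finset.univ.filter fun x : Γ => x + x ≠ 0) := by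
  intro x hx
  simp only [Finset.mem_filter, Finset.mem_univ, true_and] at hx ⊢
  exact ⟨by rwa [← neg_add, Ne, neg_eq_zero], hx⟩

lemma card_twoTorsion_add_card_filter :
    Nat.card (twoTorsion Γ) + (Finset.univ.filter fun x : Γ => x + x ≠ 0).card
      = Nat.card Γ := by
  rw [← card_filter_twoTorsion, Nat.card_eq_fintype_card, Finset.card_filter_add_card_filter_not,
    Finset.card_univ]

lemma sum_univ_eq_sum_twoTorsion :
    ∑ x : Γ, x = ∑ x ∈ Finset.univ.filter (fun x : Γ => x + x = 0), x := by
  rw [← Finset.sum_filter_add_sum_filter_not Finset.univ (fun x : Γ => x + x = 0),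
    freelySymmetric_filter.sum_eq_zero, add_zero]

lemma card_filter_add_self_eq_le (g : Γ) :
    (Finset.univ.filter fun y : Γ => y + y = g).card ≤ Nat.card (twoTorsion Γ) := by
  rw [← card_filter_twoTorsion]
  rcases (Finset.univ.filter fun y : Γ => y + y = g).eq_empty_or_nonempty with h | ⟨z, hz⟩
  · simp [h]
  · simp only [Finset.mem_filter, Finset.mem_univ, true_and] at hz
    refine Finset.card_le_card_of_injOn (fun y => y - z) ?_ (fun a _ b _ h => sub_left_injective h)
    intro y hy
    simp only [Finset.coe_filter, Finset.mem_univ, true_and, Set.mem_ofPred_eq] at hy ⊢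
    rw [sub_add_sub_comm, hy, hz, sub_self]

/-- A zero-sum set `J` of 2-torsion elements may be split in any way: as `x + x = 0` on `J`, both
parts have the same sum. Pairs `{x, -x}` fill up the two parts. -/
lemma hasBalancedPair_of_zero_sum_twoTorsion {a b j r : ℕ}
    (hJ : ∃ J : Finset (twoTorsion Γ), J.card = j ∧ ∑ x ∈ J, x = 0)
    (hn : a + b = j + 2 * r) (hr : 2 * r + Nat.card (twoTorsion Γ) ≤ Nat.card Γ)
    (ha : 1 ≤ j ∨ Even a) : HasBalancedPair Γ a b := by
  obtain ⟨J, hJc, hJ0⟩ := hJ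
  obtain ⟨i, p, hi, hai, hpr⟩ : ∃ i p, i ≤ j ∧ a = i + 2 * p ∧ p ≤ r := by
    by_cases h : a ≤ 2 * r
    · rcases Nat.even_or_odd' a with ⟨c, rfl | rfl⟩
      · exact ⟨0, c, by omega, by omega, by omega⟩
      · refine ⟨1, c, ?_, by omega, by omega⟩
        rcases ha with ha | ⟨d, hd⟩ <;> omega
    · exact ⟨a - 2 * r, r, by omega, by omega, le_rfl⟩
  obtain ⟨K, hKJ, hK⟩ := Finset.exists_subset_card_eq (s := J) (n := i) (by omega)
  let φ : twoTorsion Γ ↪ Γ := Function.Embedding.subtype _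
  have hdis : ∀ L : Finset (twoTorsion Γ),
      Disjoint (L.map φ) (Finset.univ.filter fun x : Γ => x + x ≠ 0) := by
    intro L
    rw [Finset.disjoint_left]
    intro x hx hx'
    obtain ⟨y, -, rfl⟩ := Finset.mem_map.1 hx
    exact (Finset.mem_filter.1 hx').2 y.2
  have hsum : ∑ x ∈ K, x = ∑ x ∈ J \ K, x := by
    have h1 := Finset.sum_sdiff (f := fun x => x) hKJ
    rw [hJ0] at h1
    rw [← add_right_cancel_iff (a := ∑ x ∈ K, x), h1, twoTorsion_add_self]
  refine hasBalancedPair_of_freelySymmetric (P := K.map φ) (Q := (J \ K).map φ)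
    (p := p) (q := r - p) ?_ (hdis _) (hdis _) freelySymmetric_filter ?_ ?_ ?_ ?_
  · exact (Finset.disjoint_map φ).2 Finset.disjoint_sdiff
  · rw [Finset.sum_map, Finset.sum_map]
    simpa [φ] using congrArg (fun x : twoTorsion Γ => (x : Γ)) hsum
  · rw [Finset.card_map]; omega
  · rw [Finset.card_map, Finset.card_sdiff_of_subset hKJ]; omega
  · have := card_twoTorsion_add_card_filter (Γ := Γ)
    omega

/-- If the 2-torsion has at most two elements, there is an `x` outside it such that `-x` is the
double of at most `2 - |Γ[2]|` elements: for `|Γ[2]| = 2`, half of the elements are no doubles at all. -/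
lemma exists_few_halves (hm : Nat.card (twoTorsion Γ) ≤ 2)
    (hk : Nat.card (twoTorsion Γ) + 4 < Nat.card Γ) :
    ∃ x : Γ, x + x ≠ 0 ∧ (Finset.univ.filter fun y : Γ => y + y = -x).card
      + Nat.card (twoTorsion Γ) ≤ 2 := by
  have hN := card_twoTorsion_add_card_filter (Γ := Γ)
  have hpos : 0 < Nat.card (twoTorsion Γ) := Nat.card_pos
  rcases Nat.lt_or_ge (Nat.card (twoTorsion Γ)) 2 with h | h
  · obtain ⟨x, hx⟩ := Finset.card_pos.1
      (show 0 < (Finset.univ.filter fun x : Γ => x + x ≠ 0).card by omega)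
    have := card_filter_add_self_eq_le (-x)
    exact ⟨x, (Finset.mem_filter.1 hx).2, by omega⟩
  · set D := (Finset.univ : Finset Γ).image (fun y => y + y) with hD
    have hDc : 2 * D.card ≤ (Finset.univ : Finset Γ).card := by
      refine Finset.mul_card_image_le_card _ 2 ?_
      intro g hg
      obtain ⟨z, -, rfl⟩ := Finset.mem_image.1 hg
      refine h.trans ?_
      rw [← card_filter_twoTorsion]
      refine Finset.card_le_card_of_injOn (fun y => y + z) ?_
        (fun a _ b _ h => add_right_cancel h)
      intro y hy
      simp only [Finset.coe_filter, Finset.mem_univ, true_and, Set.mem_ofPred_eq] at hy ⊢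
      rw [add_add_add_comm, hy, zero_add]
    rw [Finset.card_univ, ← Nat.card_eq_fintype_card] at hDc
    have hlt : D.card < (Finset.univ.filter fun x : Γ => x + x ≠ 0).card := by omega
    obtain ⟨x, hx, hxD⟩ := Finset.exists_mem_notMem_of_card_lt_card hlt
    refine ⟨x, (Finset.mem_filter.1 hx).2, ?_⟩
    rw [Finset.filter_false_of_mem, Finset.card_empty]
    · omega
    · intro y _ hy
      refine hxD (Finset.mem_image.2 ⟨-y, Finset.mem_univ _, ?_⟩)
      rw [← neg_add, hy, neg_neg]

/-- If the 2-torsion is small, there are `x`, `y` for which `x`, `y`, `-(x + y)` and their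
negatives are six distinct elements outside the 2-torsion. -/
lemma exists_zero_sum_triple (hm : Nat.card (twoTorsion Γ) ≤ 2)
    (hk : Nat.card (twoTorsion Γ) + 4 < Nat.card Γ) :
    ∃ x y : Γ, x + x ≠ 0 ∧ y + y ≠ 0 ∧ (x + y) + (x + y) ≠ 0 ∧ x ≠ y ∧
      x + (x + y) ≠ 0 ∧ y + (x + y) ≠ 0 := by
  obtain ⟨x, hx, hxc⟩ := exists_few_halves hm hk
  set T := Finset.univ.filter (fun y : Γ => y + y = 0) with hT
  have hTc : T.card = Nat.card (twoTorsion Γ) := card_filter_twoTorsion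
  set H := Finset.univ.filter (fun y : Γ => y + y = -x) with hH
  set B := T ∪ (T.image (fun t => t - x) ∪ ({x, -(x + x)} ∪ H)) with hB
  have hBc : B.card < (Finset.univ : Finset Γ).card := by
    have h1 : B.card ≤ T.card + ((T.image (fun t => t - x)).card +
        (({x, -(x + x)} : Finset Γ).card + H.card)) :=
      (Finset.card_union_le _ _).trans (Nat.add_le_add_left ((Finset.card_union_le _ _).trans
        (Nat.add_le_add_left (Finset.card_union_le _ _) _)) _)
    have h2 : (T.image (fun t => t - x)).card ≤ T.card := Finset.card_image_le
    have h3 : ({x, -(x + x)} : Finset Γ).card ≤ 2 := Finset.card_le_two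
    rw [Finset.card_univ, ← Nat.card_eq_fintype_card]
    omega
  obtain ⟨y, -, hy⟩ := Finset.exists_mem_notMem_of_card_lt_card hBc
  simp only [hB, hT, hH, Finset.mem_union, Finset.mem_filter, Finset.mem_univ, true_and,
    Finset.mem_image, Finset.mem_insert, Finset.mem_singleton, not_or, not_exists, not_and] at hy
  obtain ⟨h1, h2, ⟨h3, h4⟩, h5⟩ := hy
  refine ⟨x, y, hx, h1, fun h => h2 (x + y) h (by abel), fun h => h3 h.symm, fun h => h4 ?_,
    fun h => h5 ?_⟩
  · rw [eq_neg_iff_add_eq_zero, ← h]; abel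
  · rw [eq_neg_iff_add_eq_zero, ← h]; abel

/-- With a zero-sum triple `T` outside the 2-torsion, start from the balanced pair `{0}`, `T` if
enough elements may be omitted, and from `T`, `-T` if only the 2-torsion is omitted. -/
lemma hasBalancedPair_of_odd_of_odd {a b : ℕ} (ha : Odd a) (hb : Odd b) (hab : a ≤ b)
    (h3 : 3 ≤ a + b) (hm : Nat.card (twoTorsion Γ) ≤ 2)
    (hk : a + b + Nat.card (twoTorsion Γ) + 2 ≤ Nat.card Γ ∨
      a + b + Nat.card (twoTorsion Γ) = Nat.card Γ ∧ 3 ≤ a) : HasBalancedPair Γ a b := by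
  obtain ⟨c, rfl⟩ := ha
  obtain ⟨d, rfl⟩ := hb
  obtain ⟨x, y, hx, hy, hz, hxy, hxz, hyz⟩ := exists_zero_sum_triple hm (by omega)
  have hN := card_twoTorsion_add_card_filter (Γ := Γ)
  set N := Finset.univ.filter (fun x : Γ => x + x ≠ 0) with hNdef
  have hx0 : x ≠ 0 := by rintro rfl; simp at hx
  have hy0 : y ≠ 0 := by rintro rfl; simp at hy
  have hz0 : x + y ≠ 0 := fun h => hz (by rw [h, add_zero])
  set P : Finset Γ := {x, y, -(x + y)} with hP
  set Q : Finset Γ := {-x, -y, x + y} with hQ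
  have hPc : P.card = 3 := by
    rw [hP, Finset.card_eq_three]
    exact ⟨x, y, _, hxy, fun h => hxz (by nth_rewrite 1 [h]; simp),
      fun h => hyz (by nth_rewrite 1 [h]; simp), rfl⟩
  have hQP : Q = P.image (fun x => -x) := by simp [hP, hQ, Finset.image_insert]
  have hQc : Q.card = 3 := by
    rw [hQP, Finset.card_image_of_injective _ neg_injective, hPc]
  have hPs : ∑ x ∈ P, x = 0 := by
    rw [hP, Finset.sum_insert, Finset.sum_insert, Finset.sum_singleton]
    · abel
    · rw [Finset.mem_singleton]; exact fun h => hyz (by nth_rewrite 1 [h]; simp)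
    · rw [Finset.mem_insert, Finset.mem_singleton, not_or]
      exact ⟨hxy, fun h => hxz (by nth_rewrite 1 [h]; simp)⟩
  have hQs : ∑ x ∈ Q, x = 0 := by
    rw [hQP, Finset.sum_image (fun a _ b _ h => neg_injective h), Finset.sum_neg_distrib, hPs,
      neg_zero]
  have hPQ : Disjoint P Q := by
    have h1 : x ≠ -x := fun h => hx (by nth_rewrite 1 [h]; simp)
    have h2 : y ≠ -y := fun h => hy (by nth_rewrite 1 [h]; simp)
    have h3 : x + y ≠ -(x + y) := fun h => hz (by nth_rewrite 1 [h]; simp)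
    have h4 : x ≠ -y := fun h => hz0 (by rw [h]; simp)
    have h5 : y ≠ -x := fun h => hz0 (by rw [h]; simp)
    have h6 : x ≠ x + y := fun h => hy0 (by simpa using h)
    have h7 : y ≠ x + y := fun h => hx0 (by simpa using h)
    have h8 : ¬ -(x + y) = -x := by rw [neg_inj]; exact h6.symm
    have h9 : ¬ -(x + y) = -y := by rw [neg_inj]; exact h7.symm
    rw [hP, hQ, Finset.disjoint_left]
    intro w hw
    simp only [Finset.mem_insert, Finset.mem_singleton] at hw ⊢
    rcases hw with rfl | rfl | rfl
    · simp [h1, h4, h6]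
    · simp only [h2, h5, h7, or_self, not_false_eq_true]
    · simp only [h8, h9, h3.symm, or_self, not_false_eq_true]
  have hneg : ∀ w ∈ P ∪ Q, -w ∈ P ∪ Q := by
    intro w hw
    rw [hQP, Finset.mem_union, Finset.mem_image] at hw ⊢
    rcases hw with hw | ⟨v, hv, rfl⟩
    · exact Or.inr ⟨w, hw, rfl⟩
    · left; rwa [neg_neg]
  have hPQN : P ∪ Q ⊆ N := by
    intro w hw
    simp only [hP, hQ, Finset.mem_union, Finset.mem_insert, Finset.mem_singleton] at hw
    rw [hNdef, Finset.mem_filter]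
    refine ⟨Finset.mem_univ _, ?_⟩
    rcases hw with (rfl | rfl | rfl) | rfl | rfl | rfl <;>
      first
        | assumption
        | (rw [← neg_add, Ne, neg_eq_zero]; assumption)
  have hS : FreelySymmetric (N \ (P ∪ Q)) := freelySymmetric_filter.sdiff hneg
  have hSc : (N \ (P ∪ Q)).card + 6 = N.card := by
    have := Finset.card_sdiff_add_card_eq_card hPQN
    rw [Finset.card_union_of_disjoint hPQ] at this
    omega
  have hPS : Disjoint P (N \ (P ∪ Q)) :=
    Finset.disjoint_of_subset_left Finset.subset_union_left Finset.disjoint_sdiff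
  have hQS : Disjoint Q (N \ (P ∪ Q)) :=
    Finset.disjoint_of_subset_left Finset.subset_union_right Finset.disjoint_sdiff
  rcases hk with hk | ⟨hk, h3a⟩
  · have h0 : (0 : Γ) ∉ N := by simp [hNdef]
    refine hasBalancedPair_of_freelySymmetric (P := {0}) (Q := P) (p := c) (q := d - 1)
      ?_ ?_ hPS hS ?_ ?_ ?_ ?_
    · rw [Finset.disjoint_singleton_left]
      exact fun h => h0 (hPQN (Finset.mem_union_left _ h))
    · rw [Finset.disjoint_singleton_left, Finset.mem_sdiff]
      exact fun h => h0 h.1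
    · rw [Finset.sum_singleton, hPs]
    · rw [Finset.card_singleton]; omega
    · omega
    · omega
  · exact hasBalancedPair_of_freelySymmetric (p := c - 1) (q := d - 1) hPQ hPS hQS hS
      (hPs.trans hQs.symm) (by omega) (by omega) (by omega)

/-- All elements of a group of odd order sum to zero, so if `-2x` is omitted, `x` is the sum of all
elements other than itself. -/
lemma hasBalancedPair_one_of_odd_card (hm : Nat.card (twoTorsion Γ) = 1)
    {x : Γ} (hx : 3 • x ≠ 0) {b : ℕ} (hb : b + 2 = Nat.card Γ) : HasBalancedPair Γ 1 b := by
  have hne : x ≠ -(x + x) := fun h => hx (by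
    rw [succ_nsmul, two_nsmul, add_comm]; nth_rewrite 1 [h]; simp)
  refine ⟨{x}, Finset.univ \ {x, -(x + x)}, ?_, by simp, ?_, ?_⟩
  · simp
  · rw [Finset.card_sdiff_of_subset (Finset.subset_univ _), Finset.card_pair hne,
      Finset.card_univ, ← Nat.card_eq_fintype_card]
    omega
  · have h := Finset.sum_sdiff (f := fun x : Γ => x) (Finset.subset_univ {x, -(x + x)})
    have hT : (Finset.univ.filter fun x : Γ => x + x = 0) = {0} := by
      rw [← card_filter_twoTorsion, Finset.card_eq_one] at hm
      obtain ⟨t, ht⟩ := hm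
      have : (0 : Γ) ∈ Finset.univ.filter fun x : Γ => x + x = 0 := by simp
      rw [ht, Finset.mem_singleton] at this
      rw [ht, this]
    rw [sum_univ_eq_sum_twoTorsion, hT, Finset.sum_singleton, Finset.sum_pair hne,
      ← eq_neg_iff_add_eq_zero] at h
    rw [Finset.sum_singleton, h]
    abel

lemma hasBalancedPair_one_of_card_twoTorsion_eq_two (hm : Nat.card (twoTorsion Γ) = 2)
    {b : ℕ} (hb : b + 3 = Nat.card Γ) (hb2 : 2 ≤ b) : HasBalancedPair Γ 1 b := by
  have h0T : (0 : Γ) ∈ Finset.univ.filter fun x : Γ => x + x = 0 := by simp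
  obtain ⟨u, hu0, hu⟩ :
      ∃ u : Γ, 0 ≠ u ∧ (Finset.univ.filter fun x : Γ => x + x = 0) = {0, u} := by
    have := card_filter_twoTorsion (Γ := Γ)
    rw [hm, Finset.card_eq_two] at this
    obtain ⟨s, t, hst, h⟩ := this
    rw [h, Finset.mem_insert, Finset.mem_singleton] at h0T
    rcases h0T with rfl | rfl
    · exact ⟨t, hst, h⟩
    · exact ⟨s, hst.symm, by rw [h, Finset.pair_comm]⟩
  -- With `u` the involution, omit `c` and `u - c` and use `0` for the part with one element.
  obtain ⟨c, hcT, hcu⟩ : ∃ c : Γ, c + c ≠ 0 ∧ c + c ≠ u := by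
    by_contra! h
    have hle : (Finset.univ : Finset Γ).card ≤ ((Finset.univ.filter fun x : Γ => x + x = 0) ∪
        (Finset.univ.filter fun x : Γ => x + x = u)).card := by
      refine Finset.card_le_card fun c _ => ?_
      simp only [Finset.mem_union, Finset.mem_filter, Finset.mem_univ, true_and]
      by_cases hc : c + c = 0
      · exact Or.inl hc
      · exact Or.inr (h c hc)
    have h1 := hle.trans (Finset.card_union_le _ _)
    have h2 := card_filter_add_self_eq_le u
    rw [card_filter_twoTorsion, Finset.card_univ, ← Nat.card_eq_fintype_card] at h1
    rw [hm] at h2 h1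
    omega
  have hc0 : c ≠ 0 := by rintro rfl; simp at hcT
  have huc : u - c ≠ 0 := fun h => by
    have : u + u = 0 := by
      have : u ∈ Finset.univ.filter fun x : Γ => x + x = 0 := by rw [hu]; simp
      simpa using this
    rw [sub_eq_zero] at h
    exact hcT (h ▸ this)
  have hcc : c ≠ u - c := fun h => hcu (eq_sub_iff_add_eq.1 h)
  have hcard : ({0, c, u - c} : Finset Γ).card = 3 :=
    Finset.card_eq_three.2 ⟨_, _, _, hc0.symm, huc.symm, hcc, rfl⟩
  refine ⟨{0}, Finset.univ \ {0, c, u - c}, ?_, by simp, ?_, ?_⟩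
  · simp
  · rw [Finset.card_sdiff_of_subset (Finset.subset_univ _), hcard, Finset.card_univ,
      ← Nat.card_eq_fintype_card]
    omega
  · have h := Finset.sum_sdiff (f := fun x : Γ => x) (Finset.subset_univ {0, c, u - c})
    rw [sum_univ_eq_sum_twoTorsion, hu, Finset.sum_pair hu0,
      Finset.sum_insert (by simp [hc0.symm, huc.symm]), Finset.sum_pair hcc] at h
    rw [Finset.sum_singleton]
    have : c + (u - c) = u := by abel
    rw [this, zero_add] at h
    exact (add_eq_right.1 h).symm

/-- The existence of balanced pairs: the only obstructions for `3 ≤ a + b < |Γ|` are that `Γ` has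
exponent two and order `a + b + 2`, or that `Γ` has exponent three and order `a + b + 1` and one of
the two sets is a singleton. -/
theorem hasBalancedPair {a b : ℕ} (ha : 1 ≤ a) (hb : 1 ≤ b) (h3 : 3 ≤ a + b)
    (hk : a + b < Nat.card Γ)
    (h2 : ¬ ((∀ x : Γ, x + x = 0) ∧ Nat.card Γ = a + b + 2))
    (h3' : ¬ ((a = 1 ∨ b = 1) ∧ (∀ x : Γ, 3 • x = 0) ∧ Nat.card Γ = a + b + 1)) :
    HasBalancedPair Γ a b := by
  wlog hab : a ≤ b generalizing a b
  · refine (this hb ha (by omega) (by omega) ?_ ?_ (by omega)).symm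
    · rwa [add_comm b a]
    · rwa [add_comm b a, or_comm]
  have hN := card_twoTorsion_add_card_filter (Γ := Γ)
  have hNe : Even (Finset.univ.filter fun x : Γ => x + x ≠ 0).card :=
    freelySymmetric_filter.even_card
  obtain ⟨d, hd⟩ := hNe
  have hE := twoTorsion_add_self (Γ := Γ)
  have hft : Fintype (twoTorsion Γ) := Fintype.ofFinite _
  have hTc : Fintype.card (twoTorsion Γ) = Nat.card (twoTorsion Γ) :=
    Nat.card_eq_fintype_card.symm
  have hpos : 0 < Nat.card (twoTorsion Γ) := Nat.card_pos
  set m := Nat.card (twoTorsion Γ) with hm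
  rcases Nat.even_or_odd' (a + b) with ⟨c, hc | hc⟩
  · rcases Nat.lt_or_ge m 4 with hm4 | hm4
    · have hm12 : m = 1 ∨ m = 2 := by
        rcases card_twoTorsion_cases (Γ := Γ) with h | h | h <;> omega
      by_cases hae : Even a
      · exact hasBalancedPair_of_zero_sum_twoTorsion (j := 0) (r := c) ⟨∅, by simp⟩ (by omega)
          (by omega) (Or.inr hae)
      · rw [Nat.not_even_iff_odd] at hae
        have hbo : Odd b := by
          obtain ⟨e, he⟩ := hae
          exact ⟨c - e - 1, by omega⟩
        by_cases h : a + b + m + 2 ≤ Nat.card Γ ∨ a + b + m = Nat.card Γ ∧ 3 ≤ a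
        · exact hasBalancedPair_of_odd_of_odd hae hbo hab h3 (by omega) h
        · have ha1 : a = 1 := by obtain ⟨e, he⟩ := hae; omega
          subst ha1
          rcases hm12 with hm1 | hm2
          · by_cases hx : ∀ x : Γ, 3 • x = 0
            · exact absurd ⟨Or.inl rfl, hx, by omega⟩ h3'
            · push Not at hx
              obtain ⟨x, hx⟩ := hx
              exact hasBalancedPair_one_of_odd_card hm1 hx (by omega)
          · exact hasBalancedPair_one_of_card_twoTorsion_eq_two hm2 (by omega) (by omega)
    · have hm4' : 4 ∣ m := by
        rcases card_twoTorsion_cases (Γ := Γ) with h | h | h <;> omega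
      by_cases hs : a + b + m ≤ Nat.card Γ + 4
      · exact hasBalancedPair_of_zero_sum_twoTorsion (j := 4) (r := c - 2)
          (exists_zero_sum hE le_rfl (by omega)) (by omega) (by omega) (Or.inl (by omega))
      · by_cases hc2 : a + b + 2 = Nat.card Γ
        · -- The torsion subgroup is proper, so at most half of the group, and all of it is used.
          have hdvd : m ∣ Nat.card Γ := AddSubgroup.card_addSubgroup_dvd_card _
          have hne : m ≠ Nat.card Γ := by
            intro h
            refine h2 ⟨fun x => ?_, by omega⟩
            have : twoTorsion Γ = ⊤ := AddSubgroup.eq_top_of_card_eq _ h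
            exact mem_twoTorsion.1 (this ▸ AddSubgroup.mem_top x)
          have h2m : 2 * m ≤ Nat.card Γ := by
            obtain ⟨e, he⟩ := hdvd
            have : 2 ≤ e := by
              by_contra! hlt
              interval_cases e <;> omega
            calc 2 * m ≤ e * m := Nat.mul_le_mul_right _ this
              _ = Nat.card Γ := by rw [he, mul_comm]
          exact hasBalancedPair_of_zero_sum_twoTorsion (j := m) (r := (a + b - m) / 2)
            (exists_zero_sum hE hm4 (by omega)) (by omega) (by omega) (Or.inl (by omega))
        · exact hasBalancedPair_of_zero_sum_twoTorsion (j := a + b + m - Nat.card Γ) (r := d)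
            (exists_zero_sum hE (by omega) (by omega)) (by omega) (by omega)
            (Or.inl (by omega))
  · by_cases hs : a + b + m ≤ Nat.card Γ + 1
    · exact hasBalancedPair_of_zero_sum_twoTorsion (j := 1) (r := c)
        (exists_odd_zero_sum hE odd_one (by omega)) (by omega) (by omega) (Or.inl le_rfl)
    · exact hasBalancedPair_of_zero_sum_twoTorsion (j := a + b + m - Nat.card Γ) (r := d)
        (exists_odd_zero_sum hE ⟨c - d, by omega⟩ (by omega)) (by omega) (by omega)
        (Or.inl (by omega))

end Balanced

/-! ### Realizable weight functions -/

namespace SimpleGraph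

section Weights

variable {V Γ : Type*} [Fintype V] [AddCommGroup Γ] (G : SimpleGraph V)

lemma weightedDegree_add (f g : G.edgeSet → Γ) :
    G.weightedDegree (f + g) = G.weightedDegree f + G.weightedDegree g := by
  funext v
  simp [weightedDegree, Finset.sum_add_distrib]

lemma weightedDegree_neg (f : G.edgeSet → Γ) :
    G.weightedDegree (-f) = -G.weightedDegree f := by
  funext v
  simp [weightedDegree]

/-- The subgroup of those functions `w : V → Γ` that are the weighted degrees of some edge
labelling of `G`. -/
def realizableWeights (Γ : Type*) [AddCommGroup Γ] : AddSubgroup (V → Γ) where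
  carrier := {w | ∃ f : G.edgeSet → Γ, G.weightedDegree f = w}
  zero_mem' := ⟨0, by funext v; simp [weightedDegree]⟩
  add_mem' := by
    rintro _ _ ⟨f, rfl⟩ ⟨g, rfl⟩
    exact ⟨f + g, G.weightedDegree_add f g⟩
  neg_mem' := by
    rintro _ ⟨f, rfl⟩
    exact ⟨-f, G.weightedDegree_neg f⟩

variable {G}

variable [DecidableEq V]

lemma single_add_single_mem {u v : V} (h : G.Adj u v) (x : Γ) :
    Pi.single u x + Pi.single v x ∈ G.realizableWeights Γ := by
  classical
  have he : s(u, v) ∈ G.edgeSet := h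
  refine ⟨Pi.single ⟨s(u, v), he⟩ x, ?_⟩
  funext z
  have hne := h.ne
  simp only [weightedDegree, Finset.sum_pi_single', Pi.add_apply, Finset.mem_filter,
    Finset.mem_univ, true_and, Sym2.mem_iff]
  by_cases hu : z = u
  · subst hu; simp [hne]
  · by_cases hv : z = v
    · subst hv; simp [hne.symm]
    · simp [hu, hv]

/-- Alternating labels along a walk move a weight from one end to the other, up to a sign given by
the parity of the length. -/
lemma single_sub_single_mem {u v : V} (p : G.Walk u v) (x : Γ) :
    Pi.single u x - Pi.single v ((-1 : ℤ) ^ p.length • x) ∈ G.realizableWeights Γ := by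
  induction p with
  | nil => simp
  | @cons u v w h p ih =>
    have := sub_mem (single_add_single_mem h x) ih
    convert this using 1
    rw [Walk.length_cons, pow_succ, mul_neg_one, neg_smul, Pi.single_neg]
    abel

/-- All weights can be moved to a single vertex `r`. -/
lemma sub_single_sum_mem {r : V} (ε : V → ℤ)
    (hε : ∀ (v : V) (x : Γ), Pi.single v x - Pi.single r (ε v • x) ∈ G.realizableWeights Γ)
    (w : V → Γ) : w - Pi.single r (∑ v, ε v • w v) ∈ G.realizableWeights Γ := by
  have h := AddSubgroup.sum_mem (G.realizableWeights Γ) (t := Finset.univ) fun v _ => hε v (w v)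
  rw [Finset.sum_sub_distrib, Finset.univ_sum_single] at h
  convert h using 2
  exact map_sum (AddMonoidHom.single (fun _ : V => Γ) r) _ _

/-- In a connected graph, either all `w` whose total is a double are realizable (an odd closed walk
through the root exists), or the graph has a bipartition and all `w` with equal totals on the two
sides are realizable. -/
theorem realizableWeights_cases (hG : G.Connected) (Γ : Type*) [AddCommGroup Γ] :
    (∀ w : V → Γ, (∃ h, ∑ v, w v = h + h) → w ∈ G.realizableWeights Γ) ∨
      ∃ A : Finset V, (∀ u v, G.Adj u v → (u ∈ A ↔ v ∉ A)) ∧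
        ∀ w : V → Γ, ∑ v ∈ A, w v = ∑ v ∈ Aᶜ, w v → w ∈ G.realizableWeights Γ := by
  classical
  obtain ⟨r⟩ := hG.nonempty
  let p : ∀ v, G.Walk v r := fun v => (hG.preconnected v r).some
  set ε : V → ℤ := fun v => (-1) ^ (p v).length with hε
  have hmem : ∀ (v : V) (x : Γ),
      Pi.single v x - Pi.single r (ε v • x) ∈ G.realizableWeights Γ :=
    fun v x => single_sub_single_mem (p v) x
  by_cases h : ∃ v, ∃ q q' : G.Walk v r, Even q.length ∧ Odd q'.length
  · left
    rintro w ⟨h₀, hw⟩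
    obtain ⟨v, q, q', hq, hq'⟩ := h
    have h2 : ∀ x : Γ, Pi.single r (x + x) ∈ G.realizableWeights Γ := by
      intro x
      have h1 := single_sub_single_mem q x
      have h2 := single_sub_single_mem q' x
      rw [hq.neg_one_pow, one_smul] at h1
      rw [hq'.neg_one_pow, neg_one_smul, Pi.single_neg, sub_neg_eq_add] at h2
      convert sub_mem h2 h1 using 1
      rw [Pi.single_add]
      abel
    have hsum : ∃ y, ∑ v, ε v • w v = y + y := by
      refine ⟨h₀ - ∑ v ∈ Finset.univ.filter (fun v => ¬ Even (p v).length), w v, ?_⟩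
      rw [sub_add_sub_comm, ← hw, eq_sub_iff_add_eq, Finset.sum_filter,
        ← Finset.sum_add_distrib, ← Finset.sum_add_distrib]
      refine Finset.sum_congr rfl fun v _ => ?_
      by_cases hv : Even (p v).length
      · simp [hε, hv]
      · simp [hε, hv, (Nat.not_even_iff_odd.1 hv).neg_one_pow]
    obtain ⟨y, hy⟩ := hsum
    have := add_mem (sub_single_sum_mem ε hmem w) (h2 y)
    rwa [hy, sub_add_cancel] at this
  · right
    push Not at h
    refine ⟨Finset.univ.filter fun v => Even (p v).length, ?_, ?_⟩
    · intro u v huv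
      simp only [Finset.mem_filter, Finset.mem_univ, true_and, Nat.not_even_iff_odd]
      have hl : (Walk.cons huv (p v)).length = (p v).length + 1 := Walk.length_cons _ _
      constructor
      · intro hu
        have := h u _ (Walk.cons huv (p v)) hu
        rw [hl, Nat.not_odd_iff_even, Nat.even_add_one, Nat.not_even_iff_odd] at this
        exact this
      · intro hv
        by_contra hu
        exact h u (Walk.cons huv (p v)) (p u) (by rw [hl]; exact hv.add_one)
          (Nat.not_even_iff_odd.1 hu)
    · intro w hw
      have hsum : ∑ v, ε v • w v = 0 := by
        rw [← Finset.sum_add_sum_compl (Finset.univ.filter fun v => Even (p v).length)]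
        have h1 : ∑ v ∈ Finset.univ.filter (fun v => Even (p v).length), ε v • w v =
            ∑ v ∈ Finset.univ.filter (fun v => Even (p v).length), w v :=
          Finset.sum_congr rfl fun v hv => by simp [hε, (Finset.mem_filter.1 hv).2]
        have h2 : ∑ v ∈ (Finset.univ.filter fun v => Even (p v).length)ᶜ, ε v • w v =
            -∑ v ∈ (Finset.univ.filter fun v => Even (p v).length)ᶜ, w v := by
          rw [← Finset.sum_neg_distrib]
          refine Finset.sum_congr rfl fun v hv => ?_
          have hv' : Odd (p v).length := by simpa using hv
          simp [hε, hv'.neg_one_pow]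
        rw [h1, h2, hw, add_neg_cancel]
      have := sub_single_sum_mem ε hmem w
      rwa [hsum, Pi.single_zero, sub_zero] at this

end Weights

/-! ### Injective weight functions from balanced pairs -/

section Injective

variable {V Γ : Type*}

lemma exists_injOn_image_eq [DecidableEq Γ] [Nonempty Γ] {A : Finset V} {P : Finset Γ}
    (h : A.card = P.card) : ∃ g : V → Γ, Set.InjOn g A ∧ A.image g = P := by
  classical
  let e := Finset.equivOfCardEq h
  refine ⟨fun v => if hv : v ∈ A then e ⟨v, hv⟩ else Classical.arbitrary Γ, ?_, ?_⟩
  · intro u hu v hv huv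
    have hu' : u ∈ A := hu
    have hv' : v ∈ A := hv
    simpa [hu', hv'] using huv
  · ext x
    rw [Finset.mem_image]
    constructor
    · rintro ⟨v, hv, rfl⟩
      simp [hv]
    · intro hx
      exact ⟨e.symm ⟨x, hx⟩, (e.symm ⟨x, hx⟩).2, by simp⟩

lemma exists_injective_sum_eq [Fintype V] [DecidableEq V] [AddCommGroup Γ] {A : Finset V}
    (h : HasBalancedPair Γ A.card Aᶜ.card) :
    ∃ w : V → Γ, Function.Injective w ∧ ∑ v ∈ A, w v = ∑ v ∈ Aᶜ, w v := by
  classical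
  obtain ⟨P, Q, hPQ, hP, hQ, hsum⟩ := h
  obtain ⟨g, hg, hgP⟩ := exists_injOn_image_eq hP.symm
  obtain ⟨g', hg', hgQ⟩ := exists_injOn_image_eq hQ.symm
  have hA : ∀ v ∈ A, g v ∈ P := fun v hv => hgP ▸ Finset.mem_image_of_mem g hv
  have hA' : ∀ v ∉ A, g' v ∈ Q :=
    fun v hv => hgQ ▸ Finset.mem_image_of_mem g' (Finset.mem_compl.2 hv)
  refine ⟨fun v => if v ∈ A then g v else g' v, ?_, ?_⟩
  · intro u v huv
    by_cases hu : u ∈ A <;> by_cases hv : v ∈ A <;> simp only [hu, hv, if_true, if_false] at huv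
    · exact hg hu hv huv
    · exact absurd (huv ▸ hA' v hv) (Finset.disjoint_left.1 hPQ (hA u hu))
    · exact absurd (huv ▸ hA' u hu) (Finset.disjoint_left.1 hPQ (hA v hv))
    · exact hg' (by simpa using hu) (by simpa using hv) huv
  · have h1 : ∑ v ∈ A, (if v ∈ A then g v else g' v) = ∑ x ∈ P, x := by
      rw [← hgP, Finset.sum_image hg]
      exact Finset.sum_congr rfl fun v hv => if_pos hv
    have h2 : ∑ v ∈ Aᶜ, (if v ∈ A then g v else g' v) = ∑ x ∈ Q, x := by
      rw [← hgQ, Finset.sum_image hg']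
      exact Finset.sum_congr rfl fun v hv => if_neg (Finset.mem_compl.1 hv)
    rw [h1, h2, hsum]

end Injective

/-! ### Stars -/

section Star

variable {V : Type*} [Fintype V] {G : SimpleGraph V}

/-- A connected graph with a bipartition one side of which is `{r}` is a star. -/
lemma nonempty_iso_star (hG : G.Connected) (hn : 2 ≤ Fintype.card V) {r : V}
    (hr : ∀ u v, G.Adj u v → (u = r ↔ v ≠ r)) :
    Nonempty (G ≃g completeBipartiteGraph (Fin 1) (Fin (Fintype.card V - 1))) := by
  classical
  have : Nontrivial V := Fintype.one_lt_card_iff_nontrivial.1 hn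
  have hadj : ∀ v, v ≠ r → G.Adj v r := by
    intro v hv
    obtain ⟨u, hu⟩ := hG.preconnected.exists_adj_of_nontrivial v
    by_contra h
    have hur : u ≠ r := by rintro rfl; exact h hu
    exact hv ((hr v u hu).2 hur)
  have hc : Fintype.card {v // ¬ v = r} = Fintype.card (Fin (Fintype.card V - 1)) := by
    rw [Fintype.card_subtype_compl, Fintype.card_subtype_eq, Fintype.card_fin]
  have e1 : {v // v = r} ≃ Fin 1 := Fintype.equivOfCardEq (by simp)
  have e2 : {v // ¬ v = r} ≃ Fin (Fintype.card V - 1) := Fintype.equivOfCardEq hc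
  let e : V ≃ Fin 1 ⊕ Fin (Fintype.card V - 1) :=
    (Equiv.sumCompl (· = r)).symm.trans (Equiv.sumCongr e1 e2)
  have hl : ∀ v, (e v).isLeft = true ↔ v = r := by
    intro v
    by_cases hv : v = r
    · simp [e, hv, Equiv.sumCompl_symm_apply_of_pos]
    · simp [e, hv, Equiv.sumCompl_symm_apply_of_neg]
  have hR : ∀ v, (e v).isRight = true ↔ v ≠ r := by
    intro v
    rw [Ne, ← hl v]
    cases e v <;> simp
  refine ⟨⟨e, ?_⟩⟩
  intro u v
  simp only [completeBipartiteGraph_adj, hl, hR]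
  constructor
  · rintro (⟨rfl, h⟩ | ⟨h, rfl⟩)
    · exact (hadj v h).symm
    · exact hadj u h
  · intro h
    by_cases hu : u = r
    · exact Or.inl ⟨hu, (hr u v h).1 hu⟩
    · exact Or.inr ⟨hu, (hr v u h.symm).2 hu⟩

end Star

/-! ### Sufficiency -/

section Sufficiency

variable {V : Type*} [Fintype V] {G : SimpleGraph V}

/-- Sufficiency, for all groups with more than `n` elements instead of more than `s_g(G)`. -/
theorem admitsIrregularLabelling_of_card_lt (hG : G.Connected) (hn : 3 ≤ Fintype.card V)
    (Γ : Type*) [AddCommGroup Γ] [Finite Γ] (hk : Fintype.card V < Nat.card Γ)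
    (h2 : ¬ ((∀ x : Γ, x + x = 0) ∧ Nat.card Γ = Fintype.card V + 2))
    (h3 : ¬ (Nonempty (G ≃g completeBipartiteGraph (Fin 1) (Fin (Fintype.card V - 1))) ∧
      (∀ x : Γ, 3 • x = 0) ∧ Nat.card Γ = Fintype.card V + 1)) :
    G.AdmitsIrregularLabelling Γ := by
  classical
  have := Fintype.ofFinite Γ
  suffices h : ∃ w ∈ G.realizableWeights Γ, Function.Injective w by
    obtain ⟨_, ⟨f, rfl⟩, hw⟩ := h
    exact ⟨f, hw⟩
  rcases realizableWeights_cases hG Γ with h | ⟨A, hA, h⟩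
  · -- The sides of a balanced pair may be chosen freely here; a singleton is used only for `n = 3`,
    -- where `|Γ| = 4` is not a power of three.
    obtain ⟨a, ha, han, ha3⟩ : ∃ a, 1 ≤ a ∧ a + 1 ≤ Fintype.card V ∧
        (a = 1 ∨ Fintype.card V = a + 1 → Fintype.card V = 3) := by
      rcases Nat.lt_or_ge (Fintype.card V) 4 with h4 | h4
      · exact ⟨1, le_rfl, by omega, by omega⟩
      · exact ⟨2, by omega, by omega, by omega⟩
    obtain ⟨A, -, hA⟩ := Finset.exists_subset_card_eq (s := (Finset.univ : Finset V)) (n := a)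
      (by rw [Finset.card_univ]; omega)
    have hAc : A.card + Aᶜ.card = Fintype.card V := Finset.card_add_card_compl A
    obtain ⟨w, hw, hsum⟩ := exists_injective_sum_eq (A := A) (Γ := Γ)
      (hasBalancedPair (by omega) (by omega) (by omega) (by omega) (by rwa [hAc]) (by
        rintro ⟨h1, hx, hc⟩
        have hV : Fintype.card V = 3 := ha3 (by omega)
        have : Fact (Nat.Prime 3) := ⟨Nat.prime_three⟩
        obtain ⟨q, hq, -⟩ := exists_addEquiv_pi_zmod 3 hx
        have hodd : Odd (3 ^ q) := Odd.pow (by decide)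
        rw [hq, hc, hAc, hV] at hodd
        exact absurd hodd (by decide)))
    exact ⟨w, h w ⟨_, by rw [← Finset.sum_add_sum_compl A, hsum]⟩, hw⟩
  · have hAc : A.card + Aᶜ.card = Fintype.card V := Finset.card_add_card_compl A
    have : Nontrivial V := Fintype.one_lt_card_iff_nontrivial.1 (by omega)
    obtain ⟨v⟩ := hG.nonempty
    obtain ⟨u, hu⟩ := hG.preconnected.exists_adj_of_nontrivial v
    have hvu := hA v u hu
    have h1 : 1 ≤ A.card := by
      rw [Nat.one_le_iff_ne_zero, Finset.card_ne_zero]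
      by_cases hv : v ∈ A
      · exact ⟨v, hv⟩
      · exact ⟨u, by_contra fun hu => hv (hvu.2 hu)⟩
    have h1' : 1 ≤ Aᶜ.card := by
      rw [Nat.one_le_iff_ne_zero, Finset.card_ne_zero]
      by_cases hv : v ∈ A
      · exact ⟨u, Finset.mem_compl.2 (hvu.1 hv)⟩
      · exact ⟨v, Finset.mem_compl.2 hv⟩
    obtain ⟨w, hw, hsum⟩ := exists_injective_sum_eq (A := A) (Γ := Γ)
      (hasBalancedPair h1 h1' (by omega) (by omega) (by rwa [hAc]) (by
        rintro ⟨h, hx, hc⟩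
        refine h3 ⟨?_, hx, by rw [hc, hAc]⟩
        rcases h with h | h
        · obtain ⟨r, rfl⟩ := Finset.card_eq_one.1 h
          exact nonempty_iso_star hG (by omega) (r := r) (by simpa using hA)
        · obtain ⟨r, hr⟩ := Finset.card_eq_one.1 h
          have hr' : ∀ x, x ∈ A ↔ x ≠ r := by
            intro x
            rw [← not_iff_not, ← Finset.mem_compl, hr, Finset.mem_singleton, not_not]
          refine nonempty_iso_star hG (by omega) (r := r) fun x y hxy => ?_
          have := hA y x hxy.symm
          rw [hr', hr', not_not] at this
          exact this.symm))
    exact ⟨w, h w hsum, hw⟩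

lemma card_le_groupIrregularityStrength (hG : G.Connected) (hn : 3 ≤ Fintype.card V) :
    Fintype.card V ≤ G.groupIrregularityStrength := by
  -- Groups of order `n + 3` are never exceptional, so the infimum is not that of an empty set.
  have hne : {s : ℕ | 0 < s ∧ ∀ (Γ : Type) [AddCommGroup Γ], Nat.card Γ = s →
      G.AdmitsIrregularLabelling Γ}.Nonempty := by
    refine ⟨Fintype.card V + 3, by omega, fun Γ _ hΓ => ?_⟩
    have : Finite Γ := Nat.finite_of_card_ne_zero (by omega)
    exact admitsIrregularLabelling_of_card_lt hG hn Γ (by omega) (by omega) (by omega)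
  obtain ⟨hpos, h⟩ := Nat.sInf_mem hne
  change 0 < G.groupIrregularityStrength at hpos
  have : NeZero G.groupIrregularityStrength := ⟨hpos.ne'⟩
  obtain ⟨f, hf⟩ := h (ZMod G.groupIrregularityStrength) (Nat.card_zmod _)
  have hle := Nat.card_le_card_of_injective _ hf
  rwa [Nat.card_zmod, Nat.card_eq_fintype_card] at hle

end Sufficiency

/-! ### Necessity -/

section Necessity

variable {V Γ : Type*} [Fintype V] [AddCommGroup Γ] {G : SimpleGraph V}

open Classical in
lemma sum_weightedDegree (f : G.edgeSet → Γ) :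
    ∑ v, G.weightedDegree f v = ∑ e, f e + ∑ e, f e := by
  simp only [weightedDegree, Finset.sum_filter]
  rw [Finset.sum_comm, ← Finset.sum_add_distrib]
  refine Finset.sum_congr rfl fun ⟨e, he⟩ _ => ?_
  induction e using Sym2.ind with
  | _ u v =>
    have hne : u ≠ v := G.ne_of_adj he
    have : (Finset.univ.filter fun z => z ∈ s(u, v)) = {u, v} := by ext; simp
    rw [← Finset.sum_filter, this, Finset.sum_pair hne]

/-- The weighted degrees omit two elements and sum to zero, as does the whole group; hence the two
omitted elements would be equal. -/
lemma not_admits_of_two_torsion [Finite Γ] (hn : 3 ≤ Fintype.card V) (hx : ∀ x : Γ, x + x = 0)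
    (hk : Nat.card Γ = Fintype.card V + 2) : ¬ G.AdmitsIrregularLabelling Γ := by
  classical
  have := Fintype.ofFinite Γ
  rintro ⟨f, hf⟩
  rw [Nat.card_eq_fintype_card] at hk
  have hs := sum_weightedDegree f
  rw [hx] at hs
  have hc : ((Finset.univ.image (G.weightedDegree f))ᶜ).card = 2 := by
    rw [Finset.card_compl, Finset.card_image_of_injective _ hf, Finset.card_univ]
    omega
  obtain ⟨x, y, hxy, h⟩ := Finset.card_eq_two.1 hc
  have htot := Finset.sum_add_sum_compl (Finset.univ.image (G.weightedDegree f)) (fun x => x)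
  rw [sum_univ_eq_zero_of_four_le_card hx (by omega), h, Finset.sum_pair hxy,
    Finset.sum_image (fun a _ b _ h => hf h), hs, zero_add] at htot
  exact hxy (by rw [← add_right_cancel_iff (a := y), htot, hx])

/-- The weighted degrees sum to twice the degree of the centre `r`, that is, to its negative, while
the whole group sums to zero; hence the one omitted element would be the degree of `r`. -/
lemma not_admits_star_of_three_torsion [Finite Γ] (hx : ∀ x : Γ, 3 • x = 0)
    (hk : Nat.card Γ = Fintype.card V + 1) {r : V} (hr : ∀ u v, G.Adj u v → u = r ∨ v = r) :
    ¬ G.AdmitsIrregularLabelling Γ := by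
  classical
  have := Fintype.ofFinite Γ
  rintro ⟨f, hf⟩
  rw [Nat.card_eq_fintype_card] at hk
  have hwr : G.weightedDegree f r = ∑ e, f e := by
    rw [weightedDegree, Finset.filter_true_of_mem]
    rintro ⟨e, he⟩ -
    induction e using Sym2.ind with
    | _ u v =>
      rw [Sym2.mem_iff]
      exact (hr u v he).imp Eq.symm Eq.symm
  have hs := sum_weightedDegree f
  rw [← hwr] at hs
  have h3 : ∀ x : Γ, x + x = -x := fun x => by
    rw [eq_neg_iff_add_eq_zero, ← hx x]; abel
  rw [h3] at hs
  have hc : ((Finset.univ.image (G.weightedDegree f))ᶜ).card = 1 := by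
    rw [Finset.card_compl, Finset.card_image_of_injective _ hf, Finset.card_univ]
    omega
  obtain ⟨z, h⟩ := Finset.card_eq_one.1 hc
  have hΓ : ∑ x : Γ, x = 0 := by
    refine Finset.sum_involution (fun x _ => -x) (by simp) (fun a _ ha h => ha ?_) (by simp)
      (by simp)
    rw [← h3] at h
    simpa using h
  have htot := Finset.sum_add_sum_compl (Finset.univ.image (G.weightedDegree f)) (fun x => x)
  rw [hΓ, h, Finset.sum_singleton, Finset.sum_image (fun a _ b _ h => hf h), hs,
    neg_add_eq_zero] at htot
  have hz : z ∈ (Finset.univ.image (G.weightedDegree f))ᶜ := by rw [h]; simp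
  exact Finset.mem_compl.1 hz (htot ▸ Finset.mem_image_of_mem _ (Finset.mem_univ r))

end Necessity

end SimpleGraph

/-! ### The characterization -/

lemma nsmul_eq_zero_of_addEquiv_pi_zmod {Γ : Type*} [AddCommGroup Γ] {p q : ℕ}
    (e : Γ ≃+ (Fin q → ZMod p)) (x : Γ) : p • x = 0 := by
  apply e.injective
  rw [map_nsmul, map_zero]
  ext i
  simp

theorem theorem1p2 {V : Type*} [Fintype V] (G : SimpleGraph V) (hG : G.Connected)
    (n : ℕ) (hn : Fintype.card V = n) (hn3 : 3 ≤ n)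
    (k : ℕ) (hk : G.groupIrregularityStrength < k)
    (Γ : Type*) [AddCommGroup Γ] [Finite Γ] (hΓ : Nat.card Γ = k) :
    G.AdmitsIrregularLabelling Γ ↔
      ¬ ((Nonempty (G ≃g completeBipartiteGraph (Fin 1) (Fin (n - 1))) ∧
            ∃ q : ℕ, 3 ^ q = n + 1 ∧ Nonempty (Γ ≃+ (Fin q → ZMod 3))) ∨
          ∃ q : ℕ, 2 ^ q = n + 2 ∧ Nonempty (Γ ≃+ (Fin q → ZMod 2))) := by
  subst hn hΓ
  have hnk := (SimpleGraph.card_le_groupIrregularityStrength hG hn3).trans_lt hk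
  have hp2 : Fact (Nat.Prime 2) := ⟨Nat.prime_two⟩
  have hp3 : Fact (Nat.Prime 3) := ⟨Nat.prime_three⟩
  constructor
  · rintro hadm (⟨⟨φ⟩, q, hq, ⟨e⟩⟩ | ⟨q, hq, ⟨e⟩⟩)
    · refine SimpleGraph.not_admits_star_of_three_torsion (r := φ.symm (Sum.inl 0))
        (nsmul_eq_zero_of_addEquiv_pi_zmod e) ?_ ?_ hadm
      · rw [← hq, Nat.card_congr e.toEquiv, Nat.card_fun]
        simp
      · intro u v huv
        rw [← φ.map_adj_iff, completeBipartiteGraph_adj] at huv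
        have key : ∀ x, (φ x).isLeft = true → x = φ.symm (Sum.inl 0) := by
          intro x hx
          obtain ⟨i, hi⟩ := Sum.isLeft_iff.1 hx
          rw [← φ.symm_apply_apply x, hi, Subsingleton.elim i 0]
        exact huv.imp (fun h => key u h.1) (fun h => key v h.2)
    · refine SimpleGraph.not_admits_of_two_torsion hn3
        (fun x => by rw [← two_nsmul]; exact nsmul_eq_zero_of_addEquiv_pi_zmod e x) ?_ hadm
      rw [← hq, Nat.card_congr e.toEquiv, Nat.card_fun]
      simp
  · intro h
    refine SimpleGraph.admitsIrregularLabelling_of_card_lt hG hn3 Γ hnk ?_ ?_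
    · rintro ⟨hx, hc⟩
      obtain ⟨q, hq, e⟩ := exists_addEquiv_pi_zmod 2 (fun x : Γ => by rw [two_nsmul, hx])
      exact h (Or.inr ⟨q, hq.trans hc, e⟩)
    · rintro ⟨hφ, hx, hc⟩
      obtain ⟨q, hq, e⟩ := exists_addEquiv_pi_zmod 3 hx
      exact h (Or.inl ⟨hφ, q, hq.trans hc, e⟩)
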